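/- Let $E$ be a nonzero real Banach space with dual $E^*$ and pairing $\langle x,x^*\rangle := x^*(x)$. Let $S\colon E\rightrightarrows E^*$ be a multifunction with graph $G(S)=\{(s,s^*)\in E\times E^*: s^*\in S(s)\}$. Suppose that - $S$ is closed: $G(S)$ is norm-closed in $E\times E^*$; - $S$ is monotone: $\langle s-t,s^*-t^*\rangle\ge 0$ for all $(s,s^*),(t,t^*)\in G(S)$; - $S$ is quasidense: for all $(x,x^*)\in E\times E^*$, $$\inf_{(s,s^*)\in G(S)}\Big[\tfrac12\|s-x\|^2+\tfrac12\|s^*-x^*\|^2+\langle s-x,s^*-x^*\rangle\Big]\le 0$$ (with $\inf\emptyset=+\infty$, so that in particular $G(S)\ne\emptyset$). Then the following two statements hold. 1. Whenever $w\in E$ and $\widetilde W$ is a nonempty weak$^*$-compact (that is, $\sigma(E^*,E)$-compact) convex subset of $E^*$ such that $$\max_{v^*\in\widetilde W}\langle s-w,s^*-v^*\rangle\ge 0\quad\text{for all }(s,s^*)\in G(S),$$ one has $S(w)\cap\widetilde W\ne\emptyset$. 2. Whenever $W$ is a nonempty weakly compact (that is, $\sigma(E,E^*)$-compact) convex subset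 of $E$ and $w^*\in E^*$ are such that $$\max_{v\in W}\langle s-v,s^*-w^*\rangle\ge 0\quad\text{for all }(s,s^*)\in G(S),$$ one has $w^*\in S(W):=\bigcup_{v\in W}S(v)$. -/

import Mathlib

namespace Multifunction

variable {E : Type*} [NormedAddCommGroup E] [NormedSpace ℝ E]

/-- The graph `G(S)` of a multifunction `S : E ⇉ E*`. -/
def graph (S : E → Set (StrongDual ℝ E)) : Set (E × StrongDual ℝ E) :=
  {p | p.2 ∈ S p.1}

/-- `S` is closed: its graph is closed for the product of the norm topologies. -/
def IsClosedGraph (S : E → Set (StrongDual ℝ E)) : Prop :=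
  IsClosed (graph S)

/-- `S` is monotone: `⟨s - t, s* - t*⟩ ≥ 0` for all `(s, s*), (t, t*) ∈ G(S)`. -/
def IsMonotone (S : E → Set (StrongDual ℝ E)) : Prop :=
  ∀ p ∈ graph S, ∀ q ∈ graph S, 0 ≤ (p.2 - q.2) (p.1 - q.1)

/-- `S` is quasidense: for all `(x, x*)`, the infimum over `(s, s*) ∈ G(S)` of
`½‖s - x‖² + ½‖s* - x*‖² + ⟨s - x, s* - x*⟩` is at most `0`. The infimum is taken in the
extended reals, so that it is `+∞` when the graph is empty. -/
def IsQuasidense (S : E → Set (StrongDual ℝ E)) : Prop :=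
  ∀ (x : E) (x' : StrongDual ℝ E),
    (⨅ p ∈ graph S,
      ((1 / 2 * ‖p.1 - x‖ ^ 2 + 1 / 2 * ‖p.2 - x'‖ ^ 2 + (p.2 - x') (p.1 - x) : ℝ) : EReal)) ≤ 0

end Multifunction

/-!
A pairing `J : Y →L[ℝ] StrongDual ℝ X` of norm at most one covers both statements: in the second,
the roles of `E` and `E*` are exchanged and `J` is the embedding of `E` in its bidual. Let
`G ⊆ X × Y` be the graph and `W ⊆ Y` the convex set, weak*-compact in `X*`.

The epigraph of the Fitzpatrick function of `G` is convex, and by monotonicity it contains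
`(p, ⟨p⟩)` for every `p ∈ G`. Quasidensity at `(w, v)` therefore provides, for each `v ∈ W`, a point
`(x, y, ρ)` of the epigraph at which
`ρ - ⟨x, y⟩ + ⟨x - w, y - v⟩ + ½‖x - w‖² + ½‖y - v‖²` is small. Let the `v` in the bracket and the
`v` in the penalty vary independently: the bracket `ρ - ⟨x, y⟩ + ⟨x - w, y - v'⟩` equals
`ρ - ⟨w, y⟩ - ⟨x - w, v'⟩`, so the expression is convex in `((x, y, ρ), v)` and affine in `v'`, and
Sion's minimax theorem gives a single `((x, y, ρ), v)` that works for all `v' ∈ W`.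

Quasidensity at `(x, y)` now yields `p ∈ G` close to `(x, y)`, and the hypothesis on `W` at `p`
bounds `⟨x - w, y - v'⟩` from below for some `v' ∈ W`, which forces `x → w` and `y - v → 0`. In the
limit, weak* compactness gives `v ∈ W` with `(w, v)` monotonically related to `G`. A quasidense set
accumulates at every such point, and `G` is closed.
-/

open Set Filter Topology

section Compactness

theorem exists_forall_lt_of_forall_exists_lt {E F β : Type*} [LinearOrder β] [DenselyOrdered β]
    [TopologicalSpace E] [AddCommGroup E] [Module ℝ E] [IsTopologicalAddGroup E]
    [ContinuousSMul ℝ E] [TopologicalSpace F] [AddCommGroup F] [Module ℝ F]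
    [IsTopologicalAddGroup F] [ContinuousSMul ℝ F] {K : Set E} {C : Set F} {f : E → F → β} {t : β}
    (hne : K.Nonempty) (hK : Convex ℝ K) (hcomp : IsCompact K) (hC : Convex ℝ C)
    (hlsc : ∀ y ∈ C, LowerSemicontinuousOn (f · y) K) (hconv : ∀ y ∈ C, QuasiconvexOn ℝ K (f · y))
    (husc : ∀ x ∈ K, UpperSemicontinuousOn (f x) C) (hconc : ∀ x ∈ K, QuasiconcaveOn ℝ C (f x))
    (h : ∀ x ∈ K, ∃ y ∈ C, t < f x y) : ∃ y ∈ C, ∀ x ∈ K, t < f x y := by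
  choose! y hyC hlt using h
  obtain ⟨s, hsK, hcover⟩ := hcomp.elim_nhdsWithin_subcover (fun x => {x' | t < f x' (y x)})
    fun x hx => hlsc (y x) (hyC x hx) x hx t (hlt x hx)
  refine Sion.exists_lt_iInf_of_lt_iInf_of_finite hne hcomp hlsc hconv hC husc hconc hK
    (s.finite_toSet.image y) (image_subset_iff.2 fun x hx => hyC x (hsK x hx)) fun x hx => ?_
  obtain ⟨x', hx', hxt⟩ := mem_iUnion₂.1 (hcover hx)
  exact ⟨y x', mem_image_of_mem y hx', hxt⟩

theorem exists_forall_nonneg_of_tendsto_zero {ι α T : Type*} [TopologicalSpace T] {K : Set T}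
    (hK : IsCompact K) {g : ι → T → ℝ} (hg : ∀ i, Continuous (g i)) {l : Filter α} [NeBot l]
    {e : ι → α → ℝ} (he : ∀ i, Tendsto (e i) l (𝓝 0))
    (h : ∀ᶠ a in l, ∃ v ∈ K, ∀ i, -e i a ≤ g i v) : ∃ v ∈ K, ∀ i, 0 ≤ g i v := by
  obtain ⟨v, hv⟩ := h.choice
  let U := Ultrafilter.of l
  have hUl : ↑U ≤ l := Ultrafilter.of_le l
  obtain ⟨v₀, hv₀, hlim⟩ := hK.ultrafilter_le_nhds (U.map v)
    (le_principal_iff.2 (hUl (hv.mono fun _ ha => ha.1)))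
  refine ⟨v₀, hv₀, fun i => ?_⟩
  have hgv : Tendsto (fun a => g i (v a)) U (𝓝 (g i v₀)) := ((hg i).tendsto v₀).comp hlim
  have hneg : Tendsto (fun a => -e i a) U (𝓝 0) := by simpa using ((he i).mono_left hUl).neg
  exact le_of_tendsto_of_tendsto hneg hgv (hUl (hv.mono fun _ ha => ha.2 i))

end Compactness

namespace Multifunction

section Pairing

variable {X Y : Type*} [NormedAddCommGroup X] [NormedSpace ℝ X] [NormedAddCommGroup Y]
  [NormedSpace ℝ Y]

/-- Monotonicity of a subset of `X × Y` for the pairing `⟨x, y⟩ = J y x`. The pairing lets `(E, E*)`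
and `(E*, E)` be treated at once, with `J` the identity of `E*` or the embedding of `E` in its
bidual. -/
def IsMonotoneSet (J : Y →L[ℝ] StrongDual ℝ X) (G : Set (X × Y)) : Prop :=
  ∀ p ∈ G, ∀ q ∈ G, 0 ≤ J (p.2 - q.2) (p.1 - q.1)

/-- Quasidensity of a subset of `X × Y` for the pairing `⟨x, y⟩ = J y x`, with the condition that
an infimum be nonpositive expressed by approximate minimizers. -/
def IsQuasidenseSet (J : Y →L[ℝ] StrongDual ℝ X) (G : Set (X × Y)) : Prop :=
  ∀ (x : X) (y : Y), ∀ ε > 0, ∃ p ∈ G,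
    1 / 2 * ‖p.1 - x‖ ^ 2 + 1 / 2 * ‖p.2 - y‖ ^ 2 + J (p.2 - y) (p.1 - x) ≤ ε

/-- The epigraph of the Fitzpatrick function
`φ (x, y) = sup {⟨x, t⟩ + ⟨s, y⟩ - ⟨s, t⟩ | (s, t) ∈ G}`, whose values may be infinite. -/
def fitzpatrickEpigraph (J : Y →L[ℝ] StrongDual ℝ X) (G : Set (X × Y)) : Set (X × Y × ℝ) :=
  {z | ∀ q ∈ G, J q.2 z.1 + J z.2.1 q.1 - J q.2 q.1 ≤ z.2.2}

variable {J : Y →L[ℝ] StrongDual ℝ X} {G : Set (X × Y)}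

theorem mem_fitzpatrickEpigraph_iff {x : X} {y : Y} {ρ : ℝ} :
    (x, y, ρ) ∈ fitzpatrickEpigraph J G ↔
      ∀ q ∈ G, 0 ≤ ρ - J y x + J (q.2 - y) (q.1 - x) := by
  refine forall₂_congr fun q _ => ?_
  simp only [map_sub, sub_apply]
  constructor <;> intro h <;> linarith

theorem convex_fitzpatrickEpigraph : Convex ℝ (fitzpatrickEpigraph J G) := by
  intro z hz z' hz' a b ha hb hab q hq
  have h := mul_le_mul_of_nonneg_left (hz q hq) ha
  have h' := mul_le_mul_of_nonneg_left (hz' q hq) hb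
  simp only [Prod.fst_add, Prod.snd_add, Prod.smul_fst, Prod.smul_snd, map_add, map_smul,
    add_apply, smul_apply, smul_eq_mul]
  linear_combination h + h' + J q.2 q.1 * hab

theorem IsMonotoneSet.mem_fitzpatrickEpigraph (hG : IsMonotoneSet J G) {p : X × Y} (hp : p ∈ G) :
    (p.1, p.2, J p.2 p.1) ∈ fitzpatrickEpigraph J G :=
  mem_fitzpatrickEpigraph_iff.2 fun q hq => by simpa using hG q hq p hp

theorem IsQuasidenseSet.exists_half_sq_norm_le (hG : IsQuasidenseSet J G) {x : X} {y : Y} {ρ : ℝ}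
    (hz : (x, y, ρ) ∈ fitzpatrickEpigraph J G) {ε : ℝ} (hε : 0 < ε) :
    ∃ p ∈ G, 1 / 2 * ‖p.1 - x‖ ^ 2 + 1 / 2 * ‖p.2 - y‖ ^ 2 ≤ ρ - J y x + ε := by
  obtain ⟨p, hp, hle⟩ := hG x y ε hε
  exact ⟨p, hp, by linarith [mem_fitzpatrickEpigraph_iff.1 hz p hp]⟩

theorem IsQuasidenseSet.mem_closure (hG : IsQuasidenseSet J G) {w : X} {v : Y}
    (h : ∀ p ∈ G, 0 ≤ J (p.2 - v) (p.1 - w)) : (w, v) ∈ closure G := by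
  have hz : (w, v, J v w) ∈ fitzpatrickEpigraph J G :=
    mem_fitzpatrickEpigraph_iff.2 fun q hq => by simpa using h q hq
  refine Metric.mem_closure_iff.2 fun δ hδ => ?_
  obtain ⟨p, hp, hle⟩ := hG.exists_half_sq_norm_le hz (ε := δ ^ 2 / 4) (by positivity)
  have h₁ : ‖p.1 - w‖ < δ := lt_of_pow_lt_pow_left₀ 2 hδ.le (by nlinarith)
  have h₂ : ‖p.2 - v‖ < δ := lt_of_pow_lt_pow_left₀ 2 hδ.le (by nlinarith)
  exact ⟨p, hp, by rw [dist_comm, Prod.dist_eq, dist_eq_norm, dist_eq_norm]; exact max_lt h₁ h₂⟩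

theorem norm_pairing_le (hJ : ‖J‖ ≤ 1) (y : Y) : ‖J y‖ ≤ ‖y‖ := by
  simpa only [one_mul] using J.le_of_opNorm_le hJ y

theorem abs_pairing_le (hJ : ‖J‖ ≤ 1) (x : X) (y : Y) : |J y x| ≤ ‖y‖ * ‖x‖ :=
  (J y).le_of_opNorm_le (norm_pairing_le hJ y) x

theorem neg_half_sq_norm_add_le_pairing (hJ : ‖J‖ ≤ 1) (x : X) (y : Y) :
    -(1 / 2 * ‖x‖ ^ 2 + 1 / 2 * ‖y‖ ^ 2) ≤ J y x := by
  nlinarith [(abs_le.1 (abs_pairing_le hJ x y)).1, sq_nonneg (‖x‖ - ‖y‖)]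

theorem convexOn_half_sq_norm (Z : Type*) [NormedAddCommGroup Z] [NormedSpace ℝ Z] :
    ConvexOn ℝ univ fun z : Z => 1 / 2 * ‖z‖ ^ 2 :=
  ((convexOn_norm convex_univ).pow (fun _ _ => norm_nonneg _) 2).smul (by norm_num)

theorem concaveOn_penalized_pairing (J : Y →L[ℝ] StrongDual ℝ X) (w : X) (φ : StrongDual ℝ X) :
    ConcaveOn ℝ univ fun z : (X × Y × ℝ) × Y =>
      φ (z.1.1 - w) + (J z.1.2.1 w - z.1.2.2 -
        (1 / 2 * ‖z.1.1 - w‖ ^ 2 + 1 / 2 * ‖z.1.2.1 - z.2‖ ^ 2)) := by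
  have affine : ConcaveOn ℝ univ fun z : (X × Y × ℝ) × Y =>
      φ (z.1.1 - w) + (J z.1.2.1 w - z.1.2.2) := by
    refine ⟨convex_univ, fun z _ z' _ a b _ _ hab => le_of_eq ?_⟩
    simp only [map_sub, Prod.fst_add, Prod.snd_add, Prod.smul_fst, Prod.smul_snd, map_add,
      map_smul, add_apply, smul_apply, smul_eq_mul]
    linear_combination -φ w * hab
  have convex_sq_fst : ConvexOn ℝ univ fun z : (X × Y × ℝ) × Y => 1 / 2 * ‖z.1.1 - w‖ ^ 2 :=
    (convexOn_half_sq_norm X).comp_affineMap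
      ((LinearMap.fst ℝ X (Y × ℝ) ∘ₗ LinearMap.fst ℝ (X × Y × ℝ) Y).toAffineMap -
        AffineMap.const ℝ ((X × Y × ℝ) × Y) w)
  have convex_sq_sub : ConvexOn ℝ univ fun z : (X × Y × ℝ) × Y =>
      1 / 2 * ‖z.1.2.1 - z.2‖ ^ 2 :=
    (convexOn_half_sq_norm Y).comp_linearMap
      (LinearMap.fst ℝ Y ℝ ∘ₗ LinearMap.snd ℝ X (Y × ℝ) ∘ₗ LinearMap.fst ℝ (X × Y × ℝ) Y -
        LinearMap.snd ℝ (X × Y × ℝ) Y)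
  exact (affine.sub (convex_sq_fst.add convex_sq_sub)).congr fun _ _ => add_sub_assoc _ _ _

theorem exists_mem_fitzpatrickEpigraph_forall_le (hmono : IsMonotoneSet J G)
    (hqd : IsQuasidenseSet J G) {W : Set Y} (hne : W.Nonempty) (hW : Convex ℝ W)
    (hcomp : IsCompact ((fun v => StrongDual.toWeakDual (J v)) '' W)) (w : X) {ε : ℝ}
    (hε : 0 < ε) :
    ∃ x y ρ, (x, y, ρ) ∈ fitzpatrickEpigraph J G ∧ ∃ v ∈ W, ∀ v' ∈ W,
      ρ - J y x + J (y - v') (x - w) + 1 / 2 * ‖x - w‖ ^ 2 + 1 / 2 * ‖y - v‖ ^ 2 ≤ ε := by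
  let f : WeakDual ℝ X → (X × Y × ℝ) × Y → ℝ := fun φ z =>
    φ (z.1.1 - w) + (J z.1.2.1 w - z.1.2.2 -
      (1 / 2 * ‖z.1.1 - w‖ ^ 2 + 1 / 2 * ‖z.1.2.1 - z.2‖ ^ 2))
  have hf (v' : Y) (x : X) (y : Y) (ρ : ℝ) (v : Y) :
      f (StrongDual.toWeakDual (J v')) ((x, y, ρ), v) =
        -(ρ - J y x + J (y - v') (x - w) + 1 / 2 * ‖x - w‖ ^ 2 + 1 / 2 * ‖y - v‖ ^ 2) := by
    simp only [f, StrongDual.toWeakDual_apply, map_sub, sub_apply]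
    ring
  have hC : Convex ℝ (fitzpatrickEpigraph J G ×ˢ W) := convex_fitzpatrickEpigraph.prod hW
  have hconc (φ : WeakDual ℝ X) : QuasiconcaveOn ℝ (fitzpatrickEpigraph J G ×ˢ W) (f φ) :=
    ((concaveOn_penalized_pairing J w (WeakDual.toStrongDual φ)).subset
      (subset_univ _) hC).quasiconcaveOn
  have hconv (z : (X × Y × ℝ) × Y) : ConvexOn ℝ univ (f · z) :=
    ((WeakBilin.eval (topDualPairing ℝ X) (z.1.1 - w)).toLinearMap.convexOn convex_univ).add_const _
  have hcont (φ : WeakDual ℝ X) : Continuous (f φ) := by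
    have : Continuous φ := (WeakDual.toStrongDual φ).continuous
    fun_prop
  have hcontφ (z : (X × Y × ℝ) × Y) : Continuous (f · z) :=
    (WeakDual.eval_continuous _).add continuous_const
  have hK : Convex ℝ ((fun v => StrongDual.toWeakDual (J v)) '' W) :=
    hW.linear_image (StrongDual.toWeakDual.toLinearMap ∘ₗ J.toLinearMap)
  obtain ⟨⟨⟨x, y, ρ⟩, v⟩, ⟨hz, hv⟩, hlt⟩ := exists_forall_lt_of_forall_exists_lt (t := -ε)
    (hne.image _) hK hcomp hC (fun z _ => (hcontφ z).lowerSemicontinuous.lowerSemicontinuousOn _)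
    (fun z _ => ((hconv z).subset (subset_univ _) hK).quasiconvexOn)
    (fun φ _ => (hcont φ).upperSemicontinuous.upperSemicontinuousOn _)
    (fun φ _ => hconc φ) (by
      rintro _ ⟨v, hv, rfl⟩
      obtain ⟨p, hp, hle⟩ := hqd w v (ε / 2) (half_pos hε)
      refine ⟨((p.1, p.2, J p.2 p.1), v), ⟨hmono.mem_fitzpatrickEpigraph hp, hv⟩, ?_⟩
      rw [hf]
      linarith)
  refine ⟨x, y, ρ, hz, v, hv, fun v' hv' => ?_⟩
  have := hlt _ (mem_image_of_mem _ hv')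
  rw [hf] at this
  linarith

theorem exists_norm_sub_le (hJ : ‖J‖ ≤ 1) (hqd : IsQuasidenseSet J G) {W : Set Y} {M : ℝ}
    (hM : ∀ v ∈ W, ‖J v‖ ≤ M) {w : X} (hGW : ∀ p ∈ G, ∃ v ∈ W, 0 ≤ J (p.2 - v) (p.1 - w))
    {x : X} {y v : Y} {ρ d : ℝ} (hz : (x, y, ρ) ∈ fitzpatrickEpigraph J G) (hv : v ∈ W) (hd : 0 < d)
    (hle : ∀ v' ∈ W, ρ - J y x + J (y - v') (x - w) + 1 / 2 * ‖x - w‖ ^ 2 +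
      1 / 2 * ‖y - v‖ ^ 2 ≤ d ^ 2 / 4) :
    ‖x - w‖ ≤ d + √(5 * d ^ 2 + 4 * M * d) ∧ ‖y - v‖ ≤ d + √(5 * d ^ 2 + 4 * M * d) := by
  obtain ⟨p, hp, hpz⟩ := hqd.exists_half_sq_norm_le hz (ε := d ^ 2 / 4) (by positivity)
  have gap_le : ρ - J y x ≤ d ^ 2 / 4 := by
    linarith [hle v hv, neg_half_sq_norm_add_le_pairing hJ (x - w) (y - v)]
  have norm_fst_le : ‖p.1 - x‖ ≤ d := le_of_sq_le_sq (by linarith [sq_nonneg ‖p.2 - y‖]) hd.le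
  have norm_snd_le : ‖p.2 - y‖ ≤ d := le_of_sq_le_sq (by linarith [sq_nonneg ‖p.1 - x‖]) hd.le
  obtain ⟨v', hv', hpv'⟩ := hGW p hp
  have pairing_snd_le : J (p.2 - y) (x - w) ≤ d * ‖x - w‖ :=
    (le_abs_self _).trans ((abs_pairing_le hJ _ _).trans (by gcongr))
  have norm_J_le : ‖J (p.2 - v')‖ ≤ ‖y - v‖ + d + 2 * M := by
    have key : J (p.2 - v') = J (y - v) + J (p.2 - y) + (J v - J v') := by
      simp only [map_sub]
      abel
    rw [key]
    linarith [norm_pairing_le hJ (y - v), norm_pairing_le hJ (p.2 - y),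
      norm_add₃_le (a := J (y - v)) (b := J (p.2 - y)) (c := J v - J v'),
      norm_sub_le (J v) (J v'), hM v hv, hM v' hv']
  have pairing_fst_le : J (p.2 - v') (p.1 - x) ≤ (‖y - v‖ + d + 2 * M) * d :=
    (le_abs_self _).trans ((J (p.2 - v')).le_of_opNorm_le_of_le norm_J_le norm_fst_le)
  have split : J (p.2 - v') (p.1 - w) =
      J (y - v') (x - w) + J (p.2 - y) (x - w) + J (p.2 - v') (p.1 - x) := by
    simp only [map_sub, sub_apply]
    ring
  have hsq : (‖x - w‖ - d) ^ 2 + (‖y - v‖ - d) ^ 2 ≤ 5 * d ^ 2 + 4 * M * d := by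
    linarith [hle v' hv', sq_nonneg ‖p.1 - x‖, sq_nonneg ‖p.2 - y‖]
  constructor
  · linarith [Real.le_sqrt_of_sq_le (hsq.trans' (le_add_of_nonneg_right (sq_nonneg _)))]
  · linarith [Real.le_sqrt_of_sq_le (hsq.trans' (le_add_of_nonneg_left (sq_nonneg _)))]

theorem neg_le_pairing_of_mem_fitzpatrickEpigraph (hJ : ‖J‖ ≤ 1) {w x : X} {y v : Y} {ρ ε r M : ℝ}
    (hz : (x, y, ρ) ∈ fitzpatrickEpigraph J G) (hgap : ρ - J y x + J (y - v) (x - w) ≤ ε)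
    (hx : ‖x - w‖ ≤ r) (hy : ‖y - v‖ ≤ r) (hM : ‖J v‖ ≤ M) {q : X × Y} (hq : q ∈ G) :
    -(ε + (‖q.2‖ + M + ‖q.1 - w‖) * r) ≤ J (q.2 - v) (q.1 - w) := by
  have hfitz := mem_fitzpatrickEpigraph_iff.1 hz q hq
  have split : J (q.2 - y) (q.1 - x) =
      J (q.2 - v) (q.1 - w) - J (q.2 - v) (x - w) - J (y - v) (q.1 - w) + J (y - v) (x - w) := by
    simp only [map_sub, sub_apply]
    ring
  have norm_J_le : ‖J (q.2 - v)‖ ≤ ‖q.2‖ + M := by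
    rw [map_sub]
    linarith [norm_sub_le (J q.2) (J v), norm_pairing_le hJ q.2]
  have h₁ := (abs_le.1 ((J (q.2 - v)).le_of_opNorm_le_of_le norm_J_le hx)).1
  have h₂ : |J (y - v) (q.1 - w)| ≤ r * ‖q.1 - w‖ :=
    (abs_pairing_le hJ _ _).trans (by gcongr)
  linarith [(abs_le.1 h₂).1]

theorem exists_mem_forall_pairing_nonneg [CompleteSpace X] (hJ : ‖J‖ ≤ 1)
    (hmono : IsMonotoneSet J G) (hqd : IsQuasidenseSet J G) {W : Set Y} (hne : W.Nonempty)
    (hW : Convex ℝ W) (hcomp : IsCompact ((fun v => StrongDual.toWeakDual (J v)) '' W)) {w : X}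
    (hGW : ∀ p ∈ G, ∃ v ∈ W, 0 ≤ J (p.2 - v) (p.1 - w)) :
    ∃ v ∈ W, ∀ p ∈ G, 0 ≤ J (p.2 - v) (p.1 - w) := by
  obtain ⟨M, hM⟩ := (WeakDual.isBounded_iff_isVonNBounded.2
    (hcomp.isVonNBounded ℝ)).exists_norm_le
  replace hM : ∀ v ∈ W, ‖J v‖ ≤ M := fun v hv => hM _ (mem_image_of_mem _ hv)
  let g : G → WeakDual ℝ X → ℝ := fun q φ => J q.1.2 (q.1.1 - w) - φ (q.1.1 - w)
  have hg (q : G) (v : Y) : g q (StrongDual.toWeakDual (J v)) = J (q.1.2 - v) (q.1.1 - w) := by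
    rw [map_sub J]
    rfl
  let e : G → ℝ → ℝ := fun q d =>
    d ^ 2 / 4 + (‖q.1.2‖ + M + ‖q.1.1 - w‖) * (d + √(5 * d ^ 2 + 4 * M * d))
  have he (q : G) : Tendsto (e q) (𝓝[>] 0) (𝓝 0) :=
    tendsto_nhdsWithin_of_tendsto_nhds (Continuous.tendsto' (by fun_prop) 0 0 (by simp [e]))
  obtain ⟨_, ⟨v, hv, rfl⟩, hnonneg⟩ := exists_forall_nonneg_of_tendsto_zero hcomp (g := g)
    (fun q => continuous_const.sub (WeakDual.eval_continuous _)) he <| by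
      filter_upwards [self_mem_nhdsWithin] with d hd
      obtain ⟨x, y, ρ, hz, v, hv, hle⟩ := exists_mem_fitzpatrickEpigraph_forall_le hmono hqd hne hW
        hcomp w (ε := d ^ 2 / 4) (by have : 0 < d := hd; positivity)
      obtain ⟨hx, hy⟩ := exists_norm_sub_le hJ hqd hM hGW hz hv hd hle
      refine ⟨_, mem_image_of_mem _ hv, fun q => ?_⟩
      rw [hg]
      exact neg_le_pairing_of_mem_fitzpatrickEpigraph
        (ε := d ^ 2 / 4) hJ hz (by linarith [hle v hv, sq_nonneg ‖x - w‖, sq_nonneg ‖y - v‖])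
        hx hy (hM v hv) q.2
  exact ⟨v, hv, fun p hp => hg ⟨p, hp⟩ v ▸ hnonneg ⟨p, hp⟩⟩

theorem exists_mem_of_isClosed [CompleteSpace X] (hJ : ‖J‖ ≤ 1)
    (hclosed : IsClosed G) (hmono : IsMonotoneSet J G) (hqd : IsQuasidenseSet J G) {W : Set Y}
    (hne : W.Nonempty) (hW : Convex ℝ W)
    (hcomp : IsCompact ((fun v => StrongDual.toWeakDual (J v)) '' W)) {w : X}
    (hGW : ∀ p ∈ G, ∃ v ∈ W, 0 ≤ J (p.2 - v) (p.1 - w)) : ∃ v ∈ W, (w, v) ∈ G := by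
  obtain ⟨v, hv, hrel⟩ := exists_mem_forall_pairing_nonneg hJ hmono hqd hne hW hcomp hGW
  exact ⟨v, hv, hclosed.closure_subset (hqd.mem_closure hrel)⟩

end Pairing

section Graph

variable {E : Type*} [NormedAddCommGroup E] [NormedSpace ℝ E] {S : E → Set (StrongDual ℝ E)}

theorem IsQuasidense.exists_le (hqd : IsQuasidense S) (x : E) (x' : StrongDual ℝ E) {ε : ℝ}
    (hε : 0 < ε) : ∃ p ∈ graph S,
      1 / 2 * ‖p.1 - x‖ ^ 2 + 1 / 2 * ‖p.2 - x'‖ ^ 2 + (p.2 - x') (p.1 - x) ≤ ε := by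
  have h := (hqd x x').trans_lt (EReal.coe_pos.2 hε)
  simp only [iInf_lt_iff] at h
  obtain ⟨p, hp, hlt⟩ := h
  exact ⟨p, hp, (EReal.coe_lt_coe_iff.1 hlt).le⟩

theorem inter_nonempty_of_isCompact_toWeakDual [CompleteSpace E] (hclosed : IsClosedGraph S)
    (hmono : IsMonotone S) (hqd : IsQuasidense S) {w : E} {W' : Set (StrongDual ℝ E)}
    (hne : W'.Nonempty) (hconv : Convex ℝ W') (hcomp : IsCompact (StrongDual.toWeakDual '' W'))
    (h : ∀ p ∈ graph S, ∃ v' ∈ W', 0 ≤ (p.2 - v') (p.1 - w)) : (S w ∩ W').Nonempty := by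
  obtain ⟨v', hv', hmem⟩ := exists_mem_of_isClosed (J := .id ℝ (StrongDual ℝ E))
    ContinuousLinearMap.norm_id_le hclosed hmono (fun x x' ε hε => hqd.exists_le x x' hε) hne hconv
    hcomp h
  exact ⟨v', hmem, hv'⟩

theorem mem_iUnion_of_isCompact_toWeakSpace (hclosed : IsClosedGraph S)
    (hmono : IsMonotone S) (hqd : IsQuasidense S) {W : Set E} {w' : StrongDual ℝ E}
    (hne : W.Nonempty) (hconv : Convex ℝ W) (hcomp : IsCompact (toWeakSpace ℝ E '' W))
    (h : ∀ p ∈ graph S, ∃ v ∈ W, 0 ≤ (p.2 - w') (p.1 - v)) : w' ∈ ⋃ v ∈ W, S v := by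
  have hmono' : IsMonotoneSet (NormedSpace.inclusionInDoubleDual ℝ E) (Prod.swap ⁻¹' graph S) :=
    fun p hp q hq => hmono _ hp _ hq
  have hqd' : IsQuasidenseSet (NormedSpace.inclusionInDoubleDual ℝ E) (Prod.swap ⁻¹' graph S) := by
    intro x' x ε hε
    obtain ⟨p, hp, hle⟩ := hqd.exists_le x x' hε
    refine ⟨p.swap, hp, ?_⟩
    rwa [add_comm (1 / 2 * _)]
  have hcomp' : IsCompact ((fun v => StrongDual.toWeakDual
      (NormedSpace.inclusionInDoubleDual ℝ E v)) '' W) := by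
    have := hcomp.image (NormedSpace.inclusionInDoubleDualWeak ℝ E).continuous
    rwa [image_image] at this
  obtain ⟨v, hv, hmem⟩ := exists_mem_of_isClosed (NormedSpace.inclusionInDoubleDual_norm_le ℝ E)
    (hclosed.preimage continuous_swap) hmono' hqd' hne hconv hcomp' (w := w')
    fun p hp => h p.swap hp
  exact mem_iUnion₂.2 ⟨v, hv, hmem⟩

end Graph

end Multifunction

theorem mainTheorem3 {E : Type*} [NormedAddCommGroup E] [NormedSpace ℝ E] [CompleteSpace E]
    [Nontrivial E] (S : E → Set (StrongDual ℝ E))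
    (hclosed : Multifunction.IsClosedGraph S) (hmono : Multifunction.IsMonotone S)
    (hqd : Multifunction.IsQuasidense S) :
    (∀ (w : E) (W' : Set (StrongDual ℝ E)), W'.Nonempty → Convex ℝ W' →
      IsCompact (StrongDual.toWeakDual '' W') →
      (∀ p ∈ Multifunction.graph S,
        ∃ m : ℝ, IsGreatest ((fun v' : StrongDual ℝ E => (p.2 - v') (p.1 - w)) '' W') m ∧ 0 ≤ m) →
      (S w ∩ W').Nonempty) ∧
    (∀ (W : Set E) (w' : StrongDual ℝ E), W.Nonempty → Convex ℝ W →
      IsCompact (toWeakSpace ℝ E '' W) →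
      (∀ p ∈ Multifunction.graph S,
        ∃ m : ℝ, IsGreatest ((fun v : E => (p.2 - w') (p.1 - v)) '' W) m ∧ 0 ≤ m) →
      w' ∈ ⋃ v ∈ W, S v) := by
  refine ⟨fun w W' hne hconv hcomp h => ?_, fun W w' hne hconv hcomp h => ?_⟩
  · refine Multifunction.inter_nonempty_of_isCompact_toWeakDual hclosed hmono hqd hne hconv hcomp
      fun p hp => ?_
    obtain ⟨_, ⟨⟨v', hv', rfl⟩, -⟩, h0⟩ := h p hp
    exact ⟨v', hv', h0⟩
  · refine Multifunction.mem_iUnion_of_isCompact_toWeakSpace hclosed hmono hqd hne hconv hcomp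
      fun p hp => ?_
    obtain ⟨_, ⟨⟨v, hv, rfl⟩, -⟩, h0⟩ := h p hp
    exact ⟨v, hv, h0⟩
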